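/- Let $E=E_\rho\oplus iE_\rho$ be a universally complete Archimedean complex vector lattice: $E_\rho$ is an Archimedean real vector lattice that is Dedekind complete and in which every nonempty set of pairwise disjoint positive elements has a supremum, and $E$ carries the modulus $|f+ig|=\sup\{(\cos\theta)f+(\sin\theta)g:\theta\in[0,2\pi]\}$ $(f,g\in E_\rho)$. The space $E_\rho$ is endowed with its multiplication as an $f$-algebra with identity $e$, which is extended canonically to $E$; put $z^0=e$ for $z\in E$, and for $x\in E_+$ and $n\ge 1$ let $x^{1/n}$ be the unique element of $E_+$ whose $n$th power is $x$. Here $E_+=\{f\in E:|f|=f\}$ is the positive cone, which is that of $E_\rho$. Let $c\in E$, let $a_n\in E$ for $n\ge 0$, and consider the power series $S(z)=\sum_{n=0}^\infty a_n(z-c)^n$. For $r\in E_+$ let $\bar\Delta(c,r)=\{z\in E:|z-c|\le r\}$. The series *converges uniformly in order* on $D\subseteq E$, with sum $S(z)$ for $z\in D$, if there is a decreasing sequence $(p_m)_{m\ge 0}$ in $E_\rho$ with $\inf_m p_m=0$ such that $$\Bigl|\sum_{n=0}^m a_n(z-c)^n-S(z)\Bigr|\le p_m\qquad\text{for all } z\in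 D \text{ and } m\ge 0.$$ Let $$\Omega_S=\{r\in E_+ : S(z)\text{ converges uniformly in order on }\bar\Delta(c,r)\}.$$ (i) $\Omega_S$ is a solid sublattice of $E_+$: it is nonempty, it is closed under finite suprema and infima, and if $r\in\Omega_S$ and $0\le s\le r$, then $s\in\Omega_S$. (ii) If the sequence $(|a_n|^{1/n})_{n\ge1}$ is order bounded, put $L=\limsup_{n\to\infty}|a_n|^{1/n}=\inf_{n\ge1}\sup_{m\ge n}|a_m|^{1/m}$, let $B_L$ be the band of $E$ generated by $L$, and let $B_L^d=\{z\in E:|z|\wedge|w|=0\text{ for all }w\in B_L\}$ be its disjoint complement. Then $(B_L^d)_+=B_L^d\cap E_+\subseteq\Omega_S$. -/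

import Mathlib

open Set

namespace CVL

/-! ### Real vector lattices and `Φ`-algebras -/

/-- The Archimedean property of a vector lattice (Mathlib's `Archimedean` is a different property
on orders that are not total). -/
class IsArchimedeanLattice (A : Type*) [AddCommGroup A] [Lattice A] : Prop where
  nonpos_of_nsmul_le : ∀ x y : A, (∀ n : ℕ, n • x ≤ y) → x ≤ 0

/-- A vector lattice is universally complete if it is Dedekind complete, which is
`ConditionallyCompleteLattice A`, and laterally complete: every nonempty set of pairwise disjoint
positive elements has a supremum. -/
class IsUniversallyComplete (A : Type*) [AddCommGroup A] [ConditionallyCompleteLattice A] :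
    Prop where
  exists_isLUB_of_pairwise_disjoint : ∀ D : Set A, D.Nonempty → (∀ x ∈ D, 0 ≤ x) →
    D.Pairwise (fun x y => x ⊓ y = 0) → ∃ s, IsLUB D s

/-- An `f`-algebra: products of positive elements are positive, and multiplication by a positive
element, on either side, preserves disjointness. The multiplication is associative, as in every
`Ring`, and not assumed to be commutative. An `f`-algebra that is a (unital) `Ring` is a
`Φ`-algebra; its identity `e` is `1`. -/
class IsFAlgebra (A : Type*) [Ring A] [Lattice A] : Prop where
  mul_nonneg : ∀ a b : A, 0 ≤ a → 0 ≤ b → 0 ≤ a * b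
  mul_left_inf_eq_zero : ∀ a b c : A, a ⊓ b = 0 → 0 ≤ c → (c * a) ⊓ b = 0
  mul_right_inf_eq_zero : ∀ a b c : A, a ⊓ b = 0 → 0 ≤ c → (a * c) ⊓ b = 0

/-! ### The complexification `A ⊕ iA` -/

/-- The vector space complexification `A ⊕ iA`, with elements `re + i im`. -/
@[ext]
structure Cplx (A : Type*) where
  re : A
  im : A

namespace Cplx

section Algebra

variable {A : Type*} [Ring A]

instance : Zero (Cplx A) := ⟨⟨0, 0⟩⟩
instance : One (Cplx A) := ⟨⟨1, 0⟩⟩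
instance : Add (Cplx A) := ⟨fun z w => ⟨z.re + w.re, z.im + w.im⟩⟩
instance : Neg (Cplx A) := ⟨fun z => ⟨-z.re, -z.im⟩⟩
instance : Sub (Cplx A) := ⟨fun z w => ⟨z.re - w.re, z.im - w.im⟩⟩
instance : Mul (Cplx A) :=
  ⟨fun z w => ⟨z.re * w.re - z.im * w.im, z.re * w.im + z.im * w.re⟩⟩

@[simp] theorem zero_re : (0 : Cplx A).re = 0 := rfl
@[simp] theorem zero_im : (0 : Cplx A).im = 0 := rfl
@[simp] theorem one_re : (1 : Cplx A).re = 1 := rfl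
@[simp] theorem one_im : (1 : Cplx A).im = 0 := rfl
@[simp] theorem add_re (z w : Cplx A) : (z + w).re = z.re + w.re := rfl
@[simp] theorem add_im (z w : Cplx A) : (z + w).im = z.im + w.im := rfl
@[simp] theorem neg_re (z : Cplx A) : (-z).re = -z.re := rfl
@[simp] theorem neg_im (z : Cplx A) : (-z).im = -z.im := rfl
@[simp] theorem sub_re (z w : Cplx A) : (z - w).re = z.re - w.re := rfl
@[simp] theorem sub_im (z w : Cplx A) : (z - w).im = z.im - w.im := rfl
@[simp] theorem mul_re (z w : Cplx A) : (z * w).re = z.re * w.re - z.im * w.im := rfl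
@[simp] theorem mul_im (z w : Cplx A) : (z * w).im = z.re * w.im + z.im * w.re := rfl

instance : Ring (Cplx A) where
  add_assoc _ _ _ := by ext <;> simp [add_assoc]
  zero_add _ := by ext <;> simp
  add_zero _ := by ext <;> simp
  add_comm _ _ := by ext <;> simp [add_comm]
  left_distrib _ _ _ := by ext <;> simp [mul_add] <;> abel
  right_distrib _ _ _ := by ext <;> simp [add_mul] <;> abel
  zero_mul _ := by ext <;> simp
  mul_zero _ := by ext <;> simp
  mul_assoc _ _ _ := by ext <;> simp [mul_add, add_mul, mul_sub, sub_mul, mul_assoc] <;> abel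
  one_mul _ := by ext <;> simp
  mul_one _ := by ext <;> simp
  neg_add_cancel _ := by ext <;> simp
  sub_eq_add_neg _ _ := by ext <;> simp [sub_eq_add_neg]
  nsmul := nsmulRec
  zsmul := zsmulRec

variable [Algebra ℝ A]

instance : SMul ℂ (Cplx A) :=
  ⟨fun α z => ⟨α.re • z.re - α.im • z.im, α.re • z.im + α.im • z.re⟩⟩

@[simp] theorem smul_re (α : ℂ) (z : Cplx A) : (α • z).re = α.re • z.re - α.im • z.im := rfl
@[simp] theorem smul_im (α : ℂ) (z : Cplx A) : (α • z).im = α.re • z.im + α.im • z.re := rfl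

instance : Module ℂ (Cplx A) where
  one_smul _ := by ext <;> simp
  mul_smul _ _ _ := by
    ext <;> simp [smul_sub, smul_add, sub_smul, add_smul, mul_smul] <;> abel
  smul_zero _ := by ext <;> simp
  zero_smul _ := by ext <;> simp
  smul_add _ _ _ := by ext <;> simp <;> abel
  add_smul _ _ _ := by ext <;> simp [add_smul] <;> abel

/-- The inclusion of the real part `A` in `A ⊕ iA`. -/
def ofReal (x : A) : Cplx A := ⟨x, 0⟩

end Algebra

/-! ### Modulus, roots, limit superior -/

section Order

variable {A : Type*} [Ring A] [ConditionallyCompleteLattice A] [Algebra ℝ A]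

/-- The modulus `|f + ig| = sup {(cos θ) f + (sin θ) g : θ ∈ [0, 2π]}`. -/
noncomputable def modulus (z : Cplx A) : A :=
  ⨆ θ : Icc (0 : ℝ) (2 * Real.pi), (Real.cos θ • z.re + Real.sin θ • z.im)

/-- The supremum that defines the modulus is a genuine one. -/
theorem isLUB_modulus [IsOrderedAddMonoid A] [PosSMulMono ℝ A] (z : Cplx A) :
    IsLUB (range fun θ : Icc (0 : ℝ) (2 * Real.pi) =>
      Real.cos θ • z.re + Real.sin θ • z.im) z.modulus := by
  have key : ∀ (t : ℝ) (x : A), |t| ≤ 1 → t • x ≤ |x| := by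
    intro t x ht
    have h1 : t • x ≤ |t| • |x| := by
      rcases le_total 0 t with h | h
      · rw [abs_of_nonneg h]
        exact smul_le_smul_of_nonneg_left (le_abs_self x) h
      · rw [abs_of_nonpos h, ← neg_smul_neg]
        exact smul_le_smul_of_nonneg_left (neg_le_abs x) (neg_nonneg.2 h)
    have h2 : 0 ≤ (1 - |t|) • |x| := smul_nonneg (sub_nonneg.2 ht) (abs_nonneg x)
    rw [sub_smul, one_smul, sub_nonneg] at h2
    exact h1.trans h2
  have : Nonempty (Icc (0 : ℝ) (2 * Real.pi)) := ⟨⟨0, le_refl 0, Real.two_pi_pos.le⟩⟩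
  refine isLUB_csSup (range_nonempty _) ⟨|z.re| + |z.im|, ?_⟩
  rintro _ ⟨θ, rfl⟩
  exact add_le_add (key _ _ (Real.abs_cos_le_one _)) (key _ _ (Real.abs_sin_le_one _))

end Order

end Cplx

section Roots

variable {A : Type*} [Ring A] [ConditionallyCompleteLattice A]

open Classical in
/-- The positive `n`-th root `a^{1/n}` of `a`: the element `r ≥ 0` with `r ^ n = a`. In a
universally complete `Φ`-algebra it exists and is unique for `0 ≤ a` and `n ≥ 1`. -/
noncomputable def nthRoot (n : ℕ) (a : A) : A :=
  if h : ∃ r : A, 0 ≤ r ∧ r ^ n = a then h.choose else 0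

/-- `limsup x_n = inf_n sup_{m ≥ n} x_m`, for an order bounded sequence. -/
noncomputable def orderLimsup (x : ℕ → A) : A :=
  ⨅ n : ℕ, ⨆ m : Ici n, x m

/-- A set is order bounded if it is contained in an order interval. -/
def IsOrderBounded (D : Set A) : Prop :=
  ∃ l u : A, D ⊆ Icc l u

end Roots

section Complex

variable {A : Type*} [Ring A] [ConditionallyCompleteLattice A] [Algebra ℝ A]

/-- The sequence `(|a_n|^{1/n})_{n ≥ 1}`; the index `k` stands for `n = k + 1`. -/
noncomputable def rootSeq (a : ℕ → Cplx A) (k : ℕ) : A :=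
  nthRoot (k + 1) (a (k + 1)).modulus

/-! ### Bands and disjoint complements -/

/-- A band of `A ⊕ iA`: a linear subspace that is solid and contains the suprema that exist in `A`
of its nonempty sets of real elements. -/
structure IsBand (B : Submodule ℂ (Cplx A)) : Prop where
  solid : ∀ z w : Cplx A, z ∈ B → w.modulus ≤ z.modulus → w ∈ B
  sup_mem : ∀ (D : Set A) (s : A), D.Nonempty → (∀ x ∈ D, Cplx.ofReal x ∈ B) → IsLUB D s →
    Cplx.ofReal s ∈ B

/-- The band generated by `a`: the intersection of all bands that contain `a`. -/
def bandGenerated (a : Cplx A) : Submodule ℂ (Cplx A) :=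
  sInf {B | IsBand B ∧ a ∈ B}

/-- The disjoint complement of a set. -/
def disjointComplement (D : Set (Cplx A)) : Set (Cplx A) :=
  {z | ∀ w ∈ D, z.modulus ⊓ w.modulus = 0}

/-! ### Power series -/

/-- The order closed ball with center `c` and radius `r`. -/
def orderBall (c : Cplx A) (r : A) : Set (Cplx A) :=
  {z | (z - c).modulus ≤ r}

/-- The power series `∑ a_n (z - c)^n` converges uniformly in order on `D`: for some function
`S` and some sequence `p` that decreases to `0`, the `m`-th partial sum at `z` differs from `S z`
by at most `p m`, for all `z` in `D` and all `m`. In particular `S z` is the order limit of the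
partial sums at `z`. -/
def ConvergesUniformlyInOrder (a : ℕ → Cplx A) (c : Cplx A) (D : Set (Cplx A)) : Prop :=
  ∃ (S : Cplx A → Cplx A) (p : ℕ → A), Antitone p ∧ IsGLB (range p) 0 ∧
    ∀ m : ℕ, ∀ z ∈ D,
      (∑ n ∈ Finset.range (m + 1), a n * (z - c) ^ n - S z).modulus ≤ p m

/-- The set `Ω_S` of the radii `r` in the positive cone for which the power series
`∑ a_n (z - c)^n` converges uniformly in order on the ball with center `c` and radius `r`. The
positive cone of `A ⊕ iA` is that of `A`. -/
def radiiSet (a : ℕ → Cplx A) (c : Cplx A) : Set A :=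
  {r | 0 ≤ r ∧ ConvergesUniformlyInOrder a c (orderBall c r)}

end Complex

/-- A solid sublattice of the positive cone: a nonempty set of positive elements that is closed
under binary suprema and infima and contains every positive element below one of its elements. -/
structure IsSolidSublatticeOfCone {A : Type*} [AddCommGroup A] [Lattice A] (W : Set A) :
    Prop where
  nonneg : ∀ r ∈ W, 0 ≤ r
  nonempty : W.Nonempty
  solid : ∀ r ∈ W, ∀ s, 0 ≤ s → s ≤ r → s ∈ W
  sup_mem : ∀ r ∈ W, ∀ s ∈ W, r ⊔ s ∈ W
  inf_mem : ∀ r ∈ W, ∀ s ∈ W, r ⊓ s ∈ W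

end CVL

namespace CVL

/-! ### Components of the identity and order continuity of multiplication -/

section FAlgebra

variable {A : Type*} [Ring A]

/-! Components of `1`, the central idempotents `e` with `0 ≤ e ≤ 1`, play the role of indicator
functions. For any `x` and `y` some component `e` has `y ≤ x` on `e` and `x ≤ y` on `1 - e`
(`exists_isComponent_compare`), so arguments that are pointwise for functions can be carried out by
splitting along `e`.

For (i) only suprema need work. With `e` comparing `r` and `s`, a vector `w` with `|w| ≤ r ⊔ s` is
the sum of `e w`, of modulus at most `r`, and `(1 - e) w`, of modulus at most `s`. As `e` and `1 -
e` are orthogonal, powers split too (`mix_pow`); the partial sum at `w` is the sum of those at the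
two pieces minus `a 0`, and the errors add.

For (ii), let `v_n` be the suprema of the tails of the roots, which decrease to `L`. Disjointness
gives `L * r = 0`, so `v_n * r` decreases to `0` by order continuity of multiplication. Let `e_N` be
the component on which `8 v_N r` exceeds `1`; then `e_N ≤ 8 v_N r`, so `e_N` decreases to `0`. Off
`e_N` the later terms are dominated by a geometric series, so the majorant series is bounded on each
`1 - e_N`. Lateral completeness glues these bounds into a global one
(`bddAbove_range_of_forall_compl`), and the Weierstrass test applies. -/

theorem mul_eq_zero_of_inf_eq_zero [Lattice A] [IsFAlgebra A] {x y : A} (h : x ⊓ y = 0) :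
    x * y = 0 := by
  have hx : 0 ≤ x := h ▸ inf_le_left
  have hy : 0 ≤ y := h ▸ inf_le_right
  have h1 := IsFAlgebra.mul_right_inf_eq_zero x y y h hy
  rw [inf_comm] at h1
  have h2 := IsFAlgebra.mul_left_inf_eq_zero y (x * y) x h1 hx
  rwa [inf_idem] at h2

/-- A `Φ`-algebra is an ordered ring: in particular its identity is positive. -/
theorem isOrderedRing_of_isFAlgebra [Lattice A] [IsOrderedAddMonoid A] [IsFAlgebra A] :
    IsOrderedRing A := by
  have h0 : (0 : A) ≤ 1 := by
    have h1 : (1 : A)⁺ * 1⁻ = 0 := mul_eq_zero_of_inf_eq_zero (posPart_inf_negPart_eq_zero 1)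
    have h2 : (1 : A)⁻ = -((1 : A)⁻ * 1⁻) := by
      calc (1 : A)⁻ = (1⁺ - 1⁻) * 1⁻ := by rw [posPart_sub_negPart, one_mul]
        _ = _ := by rw [sub_mul, h1, zero_sub]
    have h3 : (1 : A)⁻ ≤ 0 := by
      rw [h2, neg_nonpos]
      exact IsFAlgebra.mul_nonneg _ _ (negPart_nonneg _) (negPart_nonneg _)
    have h4 : (1 : A)⁻ = 0 := le_antisymm h3 (negPart_nonneg _)
    exact negPart_eq_zero.1 h4
  have : ZeroLEOneClass A := ⟨h0⟩
  exact IsOrderedRing.of_mul_nonneg fun a b => IsFAlgebra.mul_nonneg a b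

attribute [local instance] isOrderedRing_of_isFAlgebra

theorem isOrderedModule_real [Lattice A] [IsOrderedAddMonoid A] [Algebra ℝ A]
    [PosSMulMono ℝ A] : IsOrderedModule ℝ A where
  smul_le_smul_of_nonneg_right a ha s t hst := by
    have h := smul_nonneg (sub_nonneg.2 hst) ha
    rwa [sub_smul, sub_nonneg] at h

attribute [local instance] isOrderedModule_real

/-- Central idempotents of the `Φ`-algebra that lie between `0` and `1`; multiplication by such an
element is a band projection. -/
structure IsComponent [LE A] (e : A) : Prop where
  nonneg : 0 ≤ e
  le_one : e ≤ 1
  mul_self : e * e = e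
  comm : ∀ x, e * x = x * e

variable [ConditionallyCompleteLattice A]

namespace IsComponent

variable {e f x y : A}

theorem compl [IsOrderedAddMonoid A] (he : IsComponent e) : IsComponent (1 - e) where
  nonneg := sub_nonneg.2 he.le_one
  le_one := sub_le_self _ he.nonneg
  mul_self := by rw [sub_mul, one_mul, mul_sub, he.mul_self]; simp
  comm x := by rw [sub_mul, mul_sub, he.comm]; simp

theorem mul_compl (he : IsComponent e) : e * (1 - e) = 0 := by
  rw [mul_sub, he.mul_self, mul_one, sub_self]

omit [ConditionallyCompleteLattice A] in
theorem mul_add_compl_mul (e x : A) : e * x + (1 - e) * x = x := by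
  rw [sub_mul, one_mul, add_sub_cancel]

theorem mul_mul_self (he : IsComponent e) (x : A) : e * (e * x) = e * x := by
  rw [← mul_assoc, he.mul_self]

variable [IsOrderedAddMonoid A] [IsFAlgebra A]

theorem mul_le (he : IsComponent e) (hx : 0 ≤ x) : e * x ≤ x :=
  mul_le_of_le_one_left hx he.le_one

theorem mul (he : IsComponent e) (hf : IsComponent f) : IsComponent (e * f) where
  nonneg := mul_nonneg he.nonneg hf.nonneg
  le_one := mul_le_one₀ he.le_one hf.nonneg hf.le_one
  mul_self := by
    rw [mul_assoc, hf.comm (e * f), mul_assoc, hf.mul_self, ← mul_assoc, he.mul_self]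
  comm x := by rw [mul_assoc, hf.comm, ← mul_assoc, he.comm, mul_assoc]

/-- Centrality comes from disjointness alone: for `x ≥ 0` both `e * x` and `x * e` are disjoint from
`1 - e`, so each equals `e * x * e`. -/
theorem of_inf_compl (h : e ⊓ (1 - e) = 0) : IsComponent e := by
  have h0 : 0 ≤ e := h ▸ inf_le_left
  have h1 : 0 ≤ 1 - e := h ▸ inf_le_right
  have hc : ∀ x : A, 0 ≤ x → e * x = x * e := by
    intro x hx
    have h2 : e * x * (1 - e) = 0 :=
      mul_eq_zero_of_inf_eq_zero (IsFAlgebra.mul_right_inf_eq_zero _ _ _ h hx)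
    have h3 : (1 - e) * (x * e) = 0 := by
      refine mul_eq_zero_of_inf_eq_zero ?_
      rw [inf_comm]
      exact IsFAlgebra.mul_left_inf_eq_zero _ _ _ h hx
    rw [mul_sub, mul_one, sub_eq_zero] at h2
    rw [sub_mul, one_mul, sub_eq_zero] at h3
    rw [h2, h3, mul_assoc]
  refine ⟨h0, sub_nonneg.1 h1, ?_, fun x => ?_⟩
  · have := mul_eq_zero_of_inf_eq_zero h
    rw [mul_sub, mul_one, sub_eq_zero] at this
    exact this.symm
  · rw [← posPart_sub_negPart x, mul_sub, sub_mul, hc _ (posPart_nonneg x),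
      hc _ (negPart_nonneg x)]

theorem mul_sup_add_compl_mul (he : IsComponent e) (hx : (1 - e) * x ≤ (1 - e) * y)
    (hy : e * y ≤ e * x) : x ⊔ y = e * x + (1 - e) * y := by
  apply le_antisymm
  · apply sup_le
    · conv_lhs => rw [← mul_add_compl_mul e x]
      gcongr
    · conv_lhs => rw [← mul_add_compl_mul e y]
      gcongr
  · conv_rhs => rw [← mul_add_compl_mul e (x ⊔ y)]
    have h0 := he.nonneg
    have h1 := he.compl.nonneg
    gcongr
    · exact le_sup_left
    · exact le_sup_right

end IsComponent

/-- As `e` and `1 - e` are orthogonal central idempotents, the cross terms vanish. A general ring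
allows use in both `A` and `Cplx A`. -/
theorem mix_pow {R : Type*} [Ring R] {e : R} (h2 : e * e = e) (hc : ∀ x, e * x = x * e)
    (x y : R) (n : ℕ) : (e * x + (1 - e) * y) ^ n = e * x ^ n + (1 - e) * y ^ n := by
  induction n with
  | zero => simp
  | succ n ih =>
    have k1 (u : R) : e * (e * u) = e * u := by rw [← mul_assoc, h2]
    have k2 (u v : R) : e * u * v = e * (u * v) := mul_assoc _ _ _
    have k3 (u v : R) : u * (e * v) = e * (u * v) := by rw [← mul_assoc, ← hc, mul_assoc]
    rw [pow_succ, ih, pow_succ, pow_succ]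
    simp only [sub_mul, one_mul, mul_add, add_mul, mul_sub, k2, k3, k1]
    abel

variable [IsOrderedAddMonoid A] [IsFAlgebra A]

/-- The component of `1` in the band generated by `x⁺`. -/
noncomputable def supportComponent (x : A) : A := ⨆ k : ℕ, ((k : A) * x⁺) ⊓ 1

omit [IsOrderedAddMonoid A] [IsFAlgebra A] in
theorem isLUB_supportComponent (x : A) :
    IsLUB (range fun k : ℕ => ((k : A) * x⁺) ⊓ 1) (supportComponent x) :=
  isLUB_csSup (range_nonempty _) ⟨1, by rintro _ ⟨k, rfl⟩; exact inf_le_right⟩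

theorem supportComponent_nonneg (x : A) : 0 ≤ supportComponent x := by
  refine le_trans ?_ ((isLUB_supportComponent x).1 ⟨0, rfl⟩)
  simp

theorem supportComponent_mono {x y : A} (h : x ≤ y) :
    supportComponent x ≤ supportComponent y := by
  refine (isLUB_supportComponent x).2 ?_
  rintro _ ⟨k, rfl⟩
  refine le_trans ?_ ((isLUB_supportComponent y).1 ⟨k, rfl⟩)
  have := posPart_mono h
  dsimp only
  gcongr

/-- Disjoint elements have their sum as supremum. So `w + (k * x⁺ ⊓ 1)` lies below `w ⊔
supportComponent x` for every `k`; the supremum over `k` leaves no room for a positive infimum. -/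
theorem inf_supportComponent {w x : A} (h : w ⊓ x⁺ = 0) : w ⊓ supportComponent x = 0 := by
  have hw : 0 ≤ w := h ▸ inf_le_left
  have key : w + supportComponent x ≤ w ⊔ supportComponent x := by
    rw [← le_sub_iff_add_le']
    refine (isLUB_supportComponent x).2 ?_
    rintro _ ⟨k, rfl⟩
    have h1 : w ⊓ ((k : A) * x⁺ ⊓ 1) = 0 := by
      rw [inf_comm] at h
      have := IsFAlgebra.mul_left_inf_eq_zero _ _ (k : A) h (Nat.cast_nonneg k)
      rw [← inf_assoc, inf_comm w, this]
      simp
    have h2 := inf_add_sup w ((k : A) * x⁺ ⊓ 1)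
    rw [h1, zero_add] at h2
    dsimp only
    rw [le_sub_iff_add_le', ← h2]
    exact sup_le_sup_left ((isLUB_supportComponent x).1 ⟨k, rfl⟩) _
  have h2 := inf_add_sup w (supportComponent x)
  refine le_antisymm ?_ (le_inf hw (supportComponent_nonneg x))
  rw [← h2] at key
  simpa using key

omit [IsFAlgebra A] in
-- Adding the infimum in question to `k * x⁺ ⊓ 1` gives at most `(k + 1) * x⁺ ⊓ 1`, so the supremum
-- over `k` absorbs it.
theorem compl_inf_posPart (x : A) : (1 - supportComponent x) ⊓ x⁺ = 0 := by
  have h1 : supportComponent x ≤ 1 := (isLUB_supportComponent x).2 (by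
    rintro _ ⟨k, rfl⟩; exact inf_le_right)
  refine le_antisymm ?_ (le_inf (sub_nonneg.2 h1) (posPart_nonneg x))
  suffices h : supportComponent x ≤
      supportComponent x - (1 - supportComponent x) ⊓ x⁺ by simpa using h
  refine (isLUB_supportComponent x).2 ?_
  rintro _ ⟨k, rfl⟩
  rw [le_sub_iff_add_le]
  refine le_trans (le_inf ?_ ?_) ((isLUB_supportComponent x).1 ⟨k + 1, rfl⟩)
  · push_cast
    rw [add_mul, one_mul]
    exact add_le_add inf_le_left inf_le_right
  · have := (isLUB_supportComponent x).1 ⟨k, rfl⟩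
    calc _ ≤ supportComponent x + (1 - supportComponent x) := add_le_add this inf_le_left
      _ = 1 := by abel

theorem isComponent_supportComponent (x : A) : IsComponent (supportComponent x) :=
  .of_inf_compl (by rw [inf_comm]; exact inf_supportComponent (compl_inf_posPart x))

theorem supportComponent_mul_nonneg (x : A) : 0 ≤ supportComponent x * x := by
  have h : x⁻ ⊓ supportComponent x = 0 :=
    inf_supportComponent (by rw [inf_comm]; exact posPart_inf_negPart_eq_zero x)
  rw [inf_comm] at h
  have h1 := mul_eq_zero_of_inf_eq_zero h
  have h2 : supportComponent x * x = supportComponent x * x⁺ := by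
    have h3 := congrArg (supportComponent x * ·) (posPart_sub_negPart x)
    simp only [mul_sub, h1, sub_zero] at h3
    exact h3.symm
  rw [h2]
  exact mul_nonneg (supportComponent_nonneg x) (posPart_nonneg x)

theorem compl_supportComponent_mul_nonpos (x : A) : (1 - supportComponent x) * x ≤ 0 := by
  have h1 := mul_eq_zero_of_inf_eq_zero (compl_inf_posPart x)
  have h2 := congrArg ((1 - supportComponent x) * ·) (posPart_sub_negPart x)
  simp only [mul_sub (1 - supportComponent x), h1, zero_sub] at h2
  rw [← h2, neg_nonpos]
  exact mul_nonneg (isComponent_supportComponent x).compl.nonneg (negPart_nonneg x)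

/-- The substitute for the case split `y ≤ x` or `x ≤ y` of a linear order: `e` is the support of
`(x - y)⁺`. -/
theorem exists_isComponent_compare (x y : A) :
    ∃ e, IsComponent e ∧ e * y ≤ e * x ∧ (1 - e) * x ≤ (1 - e) * y := by
  refine ⟨supportComponent (x - y), isComponent_supportComponent _, ?_, ?_⟩
  · have := supportComponent_mul_nonneg (x - y)
    rwa [mul_sub, sub_nonneg] at this
  · have := compl_supportComponent_mul_nonpos (x - y)
    rwa [mul_sub, sub_nonpos] at this

variable [Algebra ℝ A] [PosSMulMono ℝ A] [IsArchimedeanLattice A]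

/-- To show that an element is negative, it suffices to do so on the bands on which a given
positive element is bounded. -/
theorem nonpos_of_forall_isComponent {c y : A} (hc : 0 ≤ c)
    (h : ∀ (k : ℕ) (e : A), IsComponent e → e * c ≤ (k : ℝ) • e → e * y ≤ 0) : y ≤ 0 := by
  refine IsArchimedeanLattice.nonpos_of_nsmul_le y (c * y⁺) fun k => ?_
  obtain ⟨e, he, h1, h2⟩ := exists_isComponent_compare ((k : ℝ) • (1 : A)) c
  rw [mul_smul_comm, mul_one] at h1 h2
  -- Here `c ≤ k` on `e` and `c ≥ k` on `1 - e`. The hypothesis removes the part of `y` on `e`; the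
  -- rest satisfies `k • y ≤ c * y⁺`, with a bound independent of `k`.
  have h3 : y ≤ (1 - e) * y⁺ := by
    conv_lhs => rw [← IsComponent.mul_add_compl_mul e y]
    have := h k e he h1
    calc _ ≤ 0 + (1 - e) * y⁺ :=
          add_le_add this (mul_le_mul_of_nonneg_left (le_posPart y) he.compl.nonneg)
      _ = _ := zero_add _
  calc k • y = (k : ℝ) • y := (Nat.cast_smul_eq_nsmul ℝ k y).symm
    _ ≤ (k : ℝ) • ((1 - e) * y⁺) := smul_le_smul_of_nonneg_left h3 (Nat.cast_nonneg k)
    _ = ((k : ℝ) • (1 - e)) * y⁺ := (smul_mul_assoc _ _ _).symm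
    _ ≤ c * y⁺ := mul_le_mul_of_nonneg_right (h2.trans (he.compl.mul_le hc)) (posPart_nonneg y)

omit [IsOrderedAddMonoid A] [IsFAlgebra A] in
theorem nonpos_of_forall_le_smul {x y : A} (h : ∀ ε : ℝ, 0 < ε → x ≤ ε • y) : x ≤ 0 := by
  refine IsArchimedeanLattice.nonpos_of_nsmul_le x (y ⊔ 0) fun k => ?_
  rcases Nat.eq_zero_or_pos k with rfl | hk
  · simp
  have hk' : (0 : ℝ) < k := by exact_mod_cast hk
  refine le_trans ?_ le_sup_left
  have := smul_le_smul_of_nonneg_left (h (k : ℝ)⁻¹ (by positivity)) hk'.le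
  rwa [smul_smul, mul_inv_cancel₀ hk'.ne', one_smul, Nat.cast_smul_eq_nsmul] at this

/-- Multiplication by positive elements is order continuous. -/
theorem le_mul_mul_of_isGLB {T : Set A} {L b p q : A} (hT : IsGLB T L) (hp : 0 ≤ p)
    (hq : 0 ≤ q) (h : ∀ y ∈ T, b ≤ p * y * q) : b ≤ p * L * q := by
  rw [← sub_nonpos]
  refine nonpos_of_forall_isComponent (add_nonneg hp hq) fun k e he hk => ?_
  have h1 : e * p ≤ (k : ℝ) • e := le_trans
    (mul_le_mul_of_nonneg_left (le_add_of_nonneg_right hq) he.nonneg) hk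
  have h2 : e * q ≤ (k : ℝ) • e := le_trans
    (mul_le_mul_of_nonneg_left (le_add_of_nonneg_left hp) he.nonneg) hk
  set x := e * (b - p * L * q) with hx
  -- On `e` both `p` and `q` are at most `k`, so the two multiplications cost at most `k * k`; the
  -- added `1` makes `K` invertible. Then `L + K⁻¹ • x` is again a lower bound of `T`.
  set K : ℝ := (k : ℝ) * k + 1
  have hK : 0 < K := by positivity
  have h3 : ∀ y ∈ T, L + K⁻¹ • x ≤ y := by
    intro y hy
    have hLy : 0 ≤ y - L := sub_nonneg.2 (hT.1 hy)
    have h4 : x ≤ K • (y - L) := by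
      calc x ≤ e * (p * y * q - p * L * q) :=
            mul_le_mul_of_nonneg_left (sub_le_sub_right (h y hy) _) he.nonneg
        _ = (e * p) * (y - L) * (e * q) := by
            have h5 (u v : A) : u * (e * v) = e * (u * v) := by
              rw [← mul_assoc, ← he.comm, mul_assoc]
            rw [h5, mul_assoc e p, mul_assoc e, he.mul_mul_self, ← sub_mul, ← mul_sub]
        _ ≤ ((k : ℝ) • e) * (y - L) * ((k : ℝ) • e) := by
            have := he.nonneg
            have hk0 : (0 : A) ≤ (k : ℝ) • e := smul_nonneg (Nat.cast_nonneg k) this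
            gcongr
        _ = ((k : ℝ) * k) • (e * (y - L)) := by
            rw [smul_mul_assoc, smul_mul_smul_comm, mul_assoc, ← he.comm, ← mul_assoc,
              he.mul_self]
        _ ≤ ((k : ℝ) * k) • (y - L) :=
            smul_le_smul_of_nonneg_left (he.mul_le hLy) (by positivity)
        _ ≤ K • (y - L) := smul_le_smul_of_nonneg_right (by simp [K]) hLy
    have h5 := smul_le_smul_of_nonneg_left h4 (inv_nonneg.2 hK.le)
    rw [smul_smul, inv_mul_cancel₀ hK.ne', one_smul, le_sub_iff_add_le'] at h5
    exact h5
  have h6 : K⁻¹ • x ≤ 0 := by simpa using hT.2 h3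
  have h7 := smul_le_smul_of_nonneg_left h6 hK.le
  rwa [smul_smul, mul_inv_cancel₀ hK.ne', one_smul, smul_zero] at h7

theorem mul_mul_le_of_isLUB {T : Set A} {L b p q : A} (hT : IsLUB T L) (hp : 0 ≤ p)
    (hq : 0 ≤ q) (h : ∀ y ∈ T, p * y * q ≤ b) : p * L * q ≤ b := by
  have := le_mul_mul_of_isGLB (b := -b) (isGLB_neg'.2 hT) hp hq (by
    intro y hy
    have := h (-y) hy
    simpa [mul_neg, neg_mul, neg_le] using this)
  simpa using this

end FAlgebra

/-! ### Existence of roots and gluing of local bounds -/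

section Completeness

attribute [local instance] isOrderedRing_of_isFAlgebra isOrderedModule_real

variable {A : Type*} [Ring A] [ConditionallyCompleteLattice A] [IsOrderedAddMonoid A]
  [IsFAlgebra A]

theorem IsComponent.inf_compl {e : A} (he : IsComponent e) : e ⊓ (1 - e) = 0 := by
  refine le_antisymm ?_ (le_inf he.nonneg he.compl.nonneg)
  rw [← IsComponent.mul_add_compl_mul e (e ⊓ (1 - e))]
  calc _ ≤ e * (1 - e) + (1 - e) * e :=
        add_le_add (mul_le_mul_of_nonneg_left inf_le_right he.nonneg)
          (mul_le_mul_of_nonneg_left inf_le_left he.compl.nonneg)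
    _ = 0 := by rw [← he.comm, he.mul_compl, add_zero]

theorem IsComponent.mul_eq_of_le {e f : A} (he : IsComponent e) (hf : IsComponent f)
    (h : f ≤ e) : e * f = f := by
  have h1 : (1 - e) * f ≤ (1 - e) * e := mul_le_mul_of_nonneg_left h he.compl.nonneg
  rw [← he.comm, he.mul_compl] at h1
  have h2 := le_antisymm h1 (mul_nonneg he.compl.nonneg hf.nonneg)
  rw [sub_mul, one_mul, sub_eq_zero] at h2
  exact h2.symm

theorem sup_pow_le {a x y : A} (n : ℕ) (hx : x ^ n ≤ a) (hy : y ^ n ≤ a) :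
    (x ⊔ y) ^ n ≤ a := by
  obtain ⟨e, he, h1, h2⟩ := exists_isComponent_compare x y
  rw [he.mul_sup_add_compl_mul h2 h1, mix_pow he.mul_self he.comm]
  conv_rhs => rw [← IsComponent.mul_add_compl_mul e a]
  exact add_le_add (mul_le_mul_of_nonneg_left hx he.nonneg)
    (mul_le_mul_of_nonneg_left hy he.compl.nonneg)

/-- On the component where `x ≥ 1` the powers of `x` increase, and elsewhere `x ≤ 1`. This bounds
the set whose supremum is the `n`-th root. -/
theorem le_one_add_pow {x : A} (hx : 0 ≤ x) {n : ℕ} (hn : n ≠ 0) : x ≤ 1 + x ^ n := by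
  obtain ⟨e, he, h1, h2⟩ := exists_isComponent_compare x 1
  rw [mul_one] at h1 h2
  have h3 : ∀ j : ℕ, e ≤ e * x ^ j := by
    intro j
    induction j with
    | zero => simp
    | succ j ih =>
      rw [pow_succ, ← mul_assoc]
      exact h1.trans (mul_le_mul_of_nonneg_right ih hx)
  obtain ⟨j, rfl⟩ := Nat.exists_eq_succ_of_ne_zero hn
  have h4 : e * x ≤ e * x ^ (j + 1) := by
    rw [pow_succ, ← mul_assoc]
    exact mul_le_mul_of_nonneg_right (h3 j) hx
  conv_lhs => rw [← IsComponent.mul_add_compl_mul e x]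
  rw [add_comm]
  exact add_le_add (h2.trans he.compl.le_one) (h4.trans (he.mul_le (pow_nonneg hx _)))

/-- A first-order estimate for raising `r` by `δ` on a component where `r ≤ k`. The point is that
`C` depends only on `k` and `n`. -/
theorem exists_add_smul_pow_le [Algebra ℝ A] [PosSMulMono ℝ A] (k n : ℕ) :
    ∃ C : ℝ, 0 ≤ C ∧ ∀ (r g : A) (δ : ℝ), 0 ≤ r → IsComponent g → g * r ≤ (k : ℝ) • g →
      0 ≤ δ → δ ≤ 1 → (r + δ • g) ^ n ≤ r ^ n + (δ * C) • g := by
  have hpow : ∀ (n : ℕ) (r g : A), 0 ≤ r → IsComponent g → g * r ≤ (k : ℝ) • g →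
      g * r ^ n ≤ ((k : ℝ) ^ n) • g := by
    intro n r g hr hg h
    induction n with
    | zero => simp
    | succ n ih =>
      calc g * r ^ (n + 1) = g * r ^ n * r := by rw [pow_succ, mul_assoc]
        _ ≤ ((k : ℝ) ^ n) • g * r := mul_le_mul_of_nonneg_right ih hr
        _ = ((k : ℝ) ^ n) • (g * r) := smul_mul_assoc _ _ _
        _ ≤ ((k : ℝ) ^ n) • ((k : ℝ) • g) := smul_le_smul_of_nonneg_left h (by positivity)
        _ = _ := by rw [smul_smul, pow_succ]
  induction n with
  | zero => exact ⟨0, le_rfl, fun r g δ _ _ _ _ _ => by simp⟩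
  | succ n ih =>
    obtain ⟨C, hC, ih⟩ := ih
    refine ⟨(k : ℝ) ^ n + C * k + C, by positivity, fun r g δ hr hg h h0 h1 => ?_⟩
    have hg0 := hg.nonneg
    have hδg : 0 ≤ δ • g := smul_nonneg h0 hg0
    calc (r + δ • g) ^ (n + 1) = (r + δ • g) ^ n * (r + δ • g) := pow_succ _ _
      _ ≤ (r ^ n + (δ * C) • g) * (r + δ • g) :=
          mul_le_mul_of_nonneg_right (ih r g δ hr hg h h0 h1) (add_nonneg hr hδg)
      _ = r ^ (n + 1) + (δ • (g * r ^ n) + (δ * C) • (g * r) + (δ * C * δ) • g) := by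
          rw [mul_add, add_mul, add_mul, ← pow_succ, smul_mul_assoc, mul_smul_comm,
            smul_mul_smul_comm, hg.mul_self, ← hg.comm]
          abel
      _ ≤ r ^ (n + 1) + (δ • ((k : ℝ) ^ n • g) + (δ * C) • ((k : ℝ) • g) + (δ * C) • g) := by
          refine add_le_add le_rfl (add_le_add (add_le_add ?_ ?_) ?_)
          · exact smul_le_smul_of_nonneg_left (hpow n r g hr hg h) h0
          · exact smul_le_smul_of_nonneg_left h (by positivity)
          · exact smul_le_smul_of_nonneg_right (mul_le_of_le_one_right (by positivity) h1) hg0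
      _ = _ := by
          simp only [smul_smul, ← add_smul]
          ring_nf

variable [Algebra ℝ A] [PosSMulMono ℝ A] [IsArchimedeanLattice A]

/-- Every positive element has a positive `n`-th root. -/
theorem exists_nonneg_pow_eq {a : A} (ha : 0 ≤ a) {n : ℕ} (hn : n ≠ 0) :
    ∃ r : A, 0 ≤ r ∧ r ^ n = a := by
  set T : Set A := {x | 0 ≤ x ∧ x ^ n ≤ a} with hT
  have h0T : (0 : A) ∈ T := ⟨le_rfl, by rwa [zero_pow hn]⟩
  have hlub : IsLUB T (sSup T) := isLUB_csSup ⟨0, h0T⟩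
    ⟨1 + a, fun x hx => (le_one_add_pow hx.1 hn).trans (add_le_add_right hx.2 _)⟩
  set r := sSup T
  have hr : 0 ≤ r := hlub.1 h0T
  have hle : r ^ n ≤ a := by
    -- The supremum is passed through one factor at a time. Replacing a factor `r` by `y ∈ T` gives
    -- a product at most `(x ⊔ y) ^ (i + 1) * r ^ j`, and `x ⊔ y` stays in `T`.
    have key : ∀ j i : ℕ, i + j = n → ∀ x ∈ T, x ^ i * r ^ j ≤ a := by
      intro j
      induction j with
      | zero =>
        rintro i rfl x hx
        simpa using hx.2
      | succ j ih =>
        intro i hi x hx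
        rw [pow_succ', ← mul_assoc]
        refine mul_mul_le_of_isLUB hlub (pow_nonneg hx.1 _) (pow_nonneg hr _) fun y hy => ?_
        have hxy : x ⊔ y ∈ T := ⟨hx.1.trans le_sup_left, sup_pow_le n hx.2 hy.2⟩
        refine le_trans ?_ (ih (i + 1) (by omega) _ hxy)
        have := hxy.1
        have := hx.1
        have := hy.1
        rw [pow_succ]
        gcongr
        · exact le_sup_left
        · exact le_sup_right
    simpa using key n 0 (by simp) 0 h0T
  refine ⟨r, hr, le_antisymm hle ?_⟩
  rw [← sub_nonpos]
  set d := a - r ^ n with hd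
  have hd0 : 0 ≤ d := sub_nonneg.2 hle
  refine nonpos_of_forall_isComponent hr fun k e he hk => ?_
  refine nonpos_of_forall_le_smul (y := 1) fun ε hε => ?_
  -- On `f * e` the defect `d` is at least `ε` and `r` at most `k`, so `r` can be raised there by a
  -- small `δ` within `T`. Since `r` is the supremum, `f * e = 0`, and `e * d ≤ ε` follows.
  obtain ⟨f, hf, h1, h2⟩ := exists_isComponent_compare (e * d) (ε • (1 : A))
  rw [mul_smul_comm, mul_one] at h1 h2
  obtain ⟨C, hC, hpow⟩ := exists_add_smul_pow_le (A := A) k n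
  have hg : IsComponent (f * e) := hf.mul he
  set g := f * e with hgdef
  have hgr : g * r ≤ (k : ℝ) • g := by
    rw [hgdef, mul_assoc, ← mul_smul_comm]
    exact mul_le_mul_of_nonneg_left hk hf.nonneg
  obtain ⟨δ, hδ0, hδ1, hδC⟩ : ∃ δ : ℝ, 0 < δ ∧ δ ≤ 1 ∧ δ * C ≤ ε := by
    refine ⟨min 1 (ε / (C + 1)), by positivity, min_le_left _ _, ?_⟩
    calc min 1 (ε / (C + 1)) * C ≤ ε / (C + 1) * (C + 1) := by
          gcongr
          · exact min_le_right _ _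
          · simp
      _ = ε := by field_simp
  have hεg : ε • g ≤ d := by
    have h3 : ε • g ≤ ε • f := smul_le_smul_of_nonneg_left
      (by rw [hgdef, hf.comm]; exact he.mul_le hf.nonneg) hε.le
    refine h3.trans (h1.trans ?_)
    rw [← mul_assoc]
    exact hg.mul_le hd0
  have hmem : r + δ • g ∈ T := by
    refine ⟨add_nonneg hr (smul_nonneg hδ0.le hg.nonneg), ?_⟩
    calc (r + δ • g) ^ n ≤ r ^ n + (δ * C) • g := hpow r g δ hr hg hgr hδ0.le hδ1
      _ ≤ r ^ n + ε • g := by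
          have := smul_le_smul_of_nonneg_right hδC hg.nonneg
          gcongr
      _ ≤ r ^ n + d := by gcongr
      _ = a := by rw [hd]; abel
  have hg0 : g = 0 := by
    have h3 : δ • g ≤ 0 := by simpa using hlub.1 hmem
    have h4 := smul_le_smul_of_nonneg_left h3 (inv_nonneg.2 hδ0.le)
    rw [smul_smul, inv_mul_cancel₀ hδ0.ne', one_smul, smul_zero] at h4
    exact le_antisymm h4 hg.nonneg
  have h5 : f * (e * d) = 0 := by rw [← mul_assoc, ← hgdef, hg0, zero_mul]
  rw [← IsComponent.mul_add_compl_mul f (e * d), h5, zero_add]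
  exact h2.trans (smul_le_smul_of_nonneg_left hf.compl.le_one hε.le)

theorem nthRoot_spec {a : A} (ha : 0 ≤ a) {n : ℕ} (hn : n ≠ 0) :
    0 ≤ nthRoot n a ∧ nthRoot n a ^ n = a := by
  have h := exists_nonneg_pow_eq ha hn
  rw [nthRoot, dif_pos h]
  exact h.choose_spec

/-- In a universally complete `Φ`-algebra, a sequence that is bounded above on each of the bands
of a sequence of bands that increases to the whole space is bounded above. -/
theorem bddAbove_range_of_forall_compl [IsUniversallyComplete A] {e s c : ℕ → A}
    (he : ∀ N, IsComponent (e N)) (hanti : Antitone e) (hinf : IsGLB (range e) 0)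
    (hc : ∀ N, 0 ≤ c N) (h : ∀ N m, (1 - e N) * s m ≤ c N) : BddAbove (range s) := by
  -- With this shift of `e`, started at `1`, the products `f N * (1 - e N)` are the differences `e
  -- (N - 1) - e N`, and `1 - e 0` for `N = 0`: a disjoint partition of `1`.
  set f : ℕ → A := fun N => if N = 0 then 1 else e (N - 1) with hf_def
  have hf : ∀ N, IsComponent (f N) := by
    intro N
    by_cases hN : N = 0
    · simp only [hf_def, if_pos hN]
      exact ⟨zero_le_one, le_rfl, one_mul 1, fun x => by simp⟩
    · simp only [hf_def, if_neg hN]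
      exact he _
  set d : ℕ → A := fun N => f N * (1 - e N) with hd_def
  have hd : ∀ N, IsComponent (d N) := fun N => (hf N).mul (he N).compl
  have hd_le : ∀ N, d N ≤ 1 - e N := fun N => (hf N).mul_le (he N).compl.nonneg
  have hdisj : ∀ i j, i < j → d i ⊓ d j = 0 := by
    intro i j hij
    refine le_antisymm ?_ (le_inf (hd i).nonneg (hd j).nonneg)
    rw [← (he i).inf_compl, inf_comm]
    refine inf_le_inf ?_ (hd_le i)
    have h1 : f j ≤ e i := by
      simp only [hf_def, if_neg (show j ≠ 0 by omega)]
      exact hanti (by omega)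
    refine le_trans ?_ h1
    simp only [hd_def, (hf j).comm]
    exact (he j).compl.mul_le (hf j).nonneg
  obtain ⟨B, hB⟩ := IsUniversallyComplete.exists_isLUB_of_pairwise_disjoint
    (range fun N => d N * c N) (range_nonempty _)
    (by rintro _ ⟨N, rfl⟩; exact mul_nonneg (hd N).nonneg (hc N)) (by
      rintro _ ⟨i, rfl⟩ _ ⟨j, rfl⟩ hij
      have h1 : d i ⊓ d j = 0 := by
        rcases lt_trichotomy i j with hlt | rfl | hlt
        · exact hdisj i j hlt
        · exact absurd rfl hij
        · rw [inf_comm]; exact hdisj j i hlt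
      have h2 := IsFAlgebra.mul_right_inf_eq_zero _ _ _ h1 (hc i)
      rw [inf_comm] at h2
      have h3 := IsFAlgebra.mul_right_inf_eq_zero _ _ _ h2 (hc j)
      rwa [inf_comm] at h3)
  refine ⟨B, ?_⟩
  rintro _ ⟨m, rfl⟩
  have h1 : ∀ N, d N * (s m - B) ≤ 0 := by
    intro N
    have h2 : d N * s m = d N * (d N * ((1 - e N) * s m)) := by
      rw [(hd N).mul_mul_self, hd_def]
      simp only
      rw [mul_assoc, mul_assoc, (he N).compl.mul_mul_self]
    rw [mul_sub, sub_nonpos, h2]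
    exact mul_le_mul_of_nonneg_left
      ((mul_le_mul_of_nonneg_left (h N m) (hd N).nonneg).trans (hB.1 ⟨N, rfl⟩)) (hd N).nonneg
  have h2 : ∀ N, (1 - e N) * (s m - B) ≤ 0 := by
    intro N
    induction N with
    | zero => simpa [hd_def, hf_def] using h1 0
    | succ N ih =>
      have h3 : 1 - e (N + 1) = (1 - e N) + d (N + 1) := by
        simp only [hd_def, hf_def, Nat.succ_ne_zero, if_false, Nat.add_sub_cancel]
        rw [mul_sub, mul_one, (he N).mul_eq_of_le (he _) (hanti (Nat.le_succ N))]
        abel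
      rw [h3, add_mul]
      exact add_nonpos ih (h1 _)
  rw [← sub_nonpos]
  -- Only the part on `e N` can be positive, and it tends to `0` as `N` grows.
  have h3 : s m - B ≤ 1 * 0 * (s m - B)⁺ := by
    refine le_mul_mul_of_isGLB hinf zero_le_one (posPart_nonneg _) ?_
    rintro _ ⟨N, rfl⟩
    conv_lhs => rw [← IsComponent.mul_add_compl_mul (e N) (s m - B)]
    rw [one_mul, ← add_zero (e N * (s m - B)⁺)]
    exact add_le_add (mul_le_mul_of_nonneg_left (le_posPart _) (he N).nonneg) (h2 N)
  simpa using h3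

end Completeness

/-! ### The modulus on the complexification -/

section Modulus

attribute [local instance] isOrderedRing_of_isFAlgebra isOrderedModule_real

theorem abs_mul_le_abs_mul_abs {A : Type*} [Ring A] [Lattice A] [IsOrderedRing A] (x y : A) :
    |x * y| ≤ |x| * |y| := by
  have key : ∀ x y : A, x * y ≤ |x| * |y| := by
    intro x y
    have h1 := mul_nonneg (posPart_nonneg x) (negPart_nonneg y)
    have h2 := mul_nonneg (negPart_nonneg x) (posPart_nonneg y)
    rw [← sub_nonneg]
    have h3 : |x| * |y| - x * y = (x⁺ * y⁻ + x⁻ * y⁺) + (x⁺ * y⁻ + x⁻ * y⁺) := by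
      rw [← posPart_add_negPart x, ← posPart_add_negPart y]
      have h4 : x * y = (x⁺ - x⁻) * (y⁺ - y⁻) := by
        rw [posPart_sub_negPart, posPart_sub_negPart]
      rw [h4]
      noncomm_ring
    rw [h3]
    positivity
  refine abs_le'.2 ⟨key x y, ?_⟩
  rw [← neg_mul, ← abs_neg x]
  exact key _ _

theorem smul_le_abs {A : Type*} [AddCommGroup A] [Lattice A] [IsOrderedAddMonoid A] [Module ℝ A]
    [IsOrderedModule ℝ A] {t : ℝ} (ht : |t| ≤ 1) (x : A) : t • x ≤ |x| := by
  have h1 : t • x ≤ |t| • |x| := by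
    rcases le_total 0 t with h | h
    · rw [abs_of_nonneg h]
      exact smul_le_smul_of_nonneg_left (le_abs_self x) h
    · rw [abs_of_nonpos h, ← neg_smul_neg]
      exact smul_le_smul_of_nonneg_left (neg_le_abs x) (neg_nonneg.2 h)
  refine h1.trans ?_
  calc |t| • |x| ≤ (1 : ℝ) • |x| := smul_le_smul_of_nonneg_right ht (abs_nonneg x)
    _ = |x| := one_smul _ _

namespace Cplx

variable {A : Type*} [Ring A] [ConditionallyCompleteLattice A] [IsOrderedAddMonoid A]
  [Algebra ℝ A] [PosSMulMono ℝ A]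

theorem cos_smul_add_sin_smul_le_modulus (z : Cplx A) (θ : ℝ) :
    Real.cos θ • z.re + Real.sin θ • z.im ≤ z.modulus := by
  have hper : Function.Periodic (fun θ : ℝ => Real.cos θ • z.re + Real.sin θ • z.im)
      (2 * Real.pi) := fun θ => by simp
  obtain ⟨y, hy, h⟩ := hper.exists_mem_Ico₀ Real.two_pi_pos θ
  rw [h]
  exact (isLUB_modulus z).1 ⟨⟨y, hy.1, hy.2.le⟩, rfl⟩

theorem modulus_le {z : Cplx A} {b : A}
    (h : ∀ θ : ℝ, Real.cos θ • z.re + Real.sin θ • z.im ≤ b) : z.modulus ≤ b :=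
  (isLUB_modulus z).2 (by rintro _ ⟨θ, rfl⟩; exact h θ)

theorem abs_re_le_modulus (z : Cplx A) : |z.re| ≤ z.modulus := by
  have h1 := cos_smul_add_sin_smul_le_modulus z 0
  have h2 := cos_smul_add_sin_smul_le_modulus z Real.pi
  simp at h1 h2
  exact abs_le'.2 ⟨h1, h2⟩

theorem abs_im_le_modulus (z : Cplx A) : |z.im| ≤ z.modulus := by
  have h1 := cos_smul_add_sin_smul_le_modulus z (Real.pi / 2)
  have h2 := cos_smul_add_sin_smul_le_modulus z (-(Real.pi / 2))
  simp at h1 h2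
  exact abs_le'.2 ⟨h1, h2⟩

theorem modulus_nonneg (z : Cplx A) : 0 ≤ z.modulus :=
  (abs_nonneg _).trans (abs_re_le_modulus z)

theorem modulus_le_abs_add_abs (z : Cplx A) : z.modulus ≤ |z.re| + |z.im| :=
  modulus_le fun θ => add_le_add (smul_le_abs (Real.abs_cos_le_one θ) _)
    (smul_le_abs (Real.abs_sin_le_one θ) _)

@[simp] theorem modulus_zero : (0 : Cplx A).modulus = 0 :=
  le_antisymm (by simpa using modulus_le_abs_add_abs (0 : Cplx A)) (modulus_nonneg _)

theorem eq_zero_of_modulus_nonpos {z : Cplx A} (h : z.modulus ≤ 0) : z = 0 := by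
  have key : ∀ x : A, |x| ≤ 0 → x = 0 := fun x hx => by
    have h' := abs_le'.1 hx
    exact le_antisymm h'.1 (neg_nonpos.1 h'.2)
  ext
  · exact key _ ((abs_re_le_modulus z).trans h)
  · exact key _ ((abs_im_le_modulus z).trans h)

theorem modulus_add_le (z w : Cplx A) : (z + w).modulus ≤ z.modulus + w.modulus :=
  modulus_le fun θ => by
    have := add_le_add (cos_smul_add_sin_smul_le_modulus z θ)
      (cos_smul_add_sin_smul_le_modulus w θ)
    refine le_trans (le_of_eq ?_) this
    simp only [add_re, add_im, smul_add]
    abel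

theorem modulus_neg_le (z : Cplx A) : (-z).modulus ≤ z.modulus :=
  modulus_le fun θ => by
    simpa using cos_smul_add_sin_smul_le_modulus z (θ + Real.pi)

variable [IsFAlgebra A]

/-- The constant is crude: four real products, each at most `z.modulus * w.modulus`. The root test
below can absorb the resulting factor `4 ^ n`, so no sharper bound is needed. -/
theorem modulus_mul_le (z w : Cplx A) :
    (z * w).modulus ≤ (4 : ℝ) • (z.modulus * w.modulus) := by
  have key : ∀ x y : A, |x| ≤ z.modulus → |y| ≤ w.modulus →
      |x * y| ≤ z.modulus * w.modulus := fun x y hx hy =>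
    (abs_mul_le_abs_mul_abs x y).trans (mul_le_mul hx hy (abs_nonneg y) (modulus_nonneg z))
  have hz := abs_re_le_modulus z
  have hz' := abs_im_le_modulus z
  have hw := abs_re_le_modulus w
  have hw' := abs_im_le_modulus w
  refine (modulus_le_abs_add_abs _).trans ?_
  have h1 : |(z * w).re| ≤ z.modulus * w.modulus + z.modulus * w.modulus := by
    rw [mul_re, sub_eq_add_neg]
    refine (abs_add_le _ _).trans (add_le_add (key _ _ hz hw) ?_)
    rw [abs_neg]
    exact key _ _ hz' hw'
  have h2 : |(z * w).im| ≤ z.modulus * w.modulus + z.modulus * w.modulus := by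
    rw [mul_im]
    exact (abs_add_le _ _).trans (add_le_add (key _ _ hz hw') (key _ _ hz' hw))
  refine (add_le_add h1 h2).trans (le_of_eq ?_)
  rw [show (4 : ℝ) = 1 + 1 + 1 + 1 by norm_num]
  simp only [add_smul, one_smul]
  abel

theorem modulus_mul_pow_le (a w : Cplx A) {r : A} (h : w.modulus ≤ r) (n : ℕ) :
    (a * w ^ n).modulus ≤ ((4 : ℝ) ^ n) • (a.modulus * r ^ n) := by
  have hr : 0 ≤ r := (modulus_nonneg w).trans h
  induction n with
  | zero => simp
  | succ n ih =>
    have h1 : 0 ≤ a.modulus * r ^ n := mul_nonneg (modulus_nonneg a) (pow_nonneg hr n)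
    rw [pow_succ, ← mul_assoc]
    refine (modulus_mul_le _ _).trans ?_
    calc (4 : ℝ) • ((a * w ^ n).modulus * w.modulus)
        ≤ (4 : ℝ) • ((((4 : ℝ) ^ n) • (a.modulus * r ^ n)) * r) := by
          refine smul_le_smul_of_nonneg_left ?_ (by norm_num)
          exact mul_le_mul ih h (modulus_nonneg w) (smul_nonneg (by positivity) h1)
      _ = _ := by
          rw [smul_mul_assoc, smul_smul, mul_assoc, ← pow_succ, ← pow_succ']

omit [IsOrderedAddMonoid A] [Algebra ℝ A] [PosSMulMono ℝ A] [IsFAlgebra A] in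
theorem ofReal_mul_self {e : A} (he : IsComponent e) : ofReal e * ofReal e = ofReal e := by
  ext <;> simp [ofReal, he.mul_self]

omit [IsOrderedAddMonoid A] [Algebra ℝ A] [PosSMulMono ℝ A] [IsFAlgebra A] in
theorem ofReal_comm {e : A} (he : IsComponent e) (z : Cplx A) :
    ofReal e * z = z * ofReal e := by
  ext <;> simp [ofReal, he.comm]

theorem modulus_ofReal_mul_le {e : A} (he : IsComponent e) (z : Cplx A) :
    (ofReal e * z).modulus ≤ e * z.modulus :=
  modulus_le fun θ => by
    have := mul_le_mul_of_nonneg_left (cos_smul_add_sin_smul_le_modulus z θ) he.nonneg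
    simpa [ofReal, mul_add] using this

omit [ConditionallyCompleteLattice A] [IsOrderedAddMonoid A] [Algebra ℝ A] [PosSMulMono ℝ A]
  [IsFAlgebra A] in
theorem ofReal_one_sub (e : A) : ofReal (1 - e) = 1 - ofReal e := by
  ext <;> simp [ofReal]

end Cplx

/-! ### The Weierstrass test -/

section Series

variable {A : Type*} [Ring A] [ConditionallyCompleteLattice A] [IsOrderedAddMonoid A]
  [Algebra ℝ A] [PosSMulMono ℝ A]

open Cplx

omit [Algebra ℝ A] [PosSMulMono ℝ A] in
theorem isGLB_add_of_antitone {p q : ℕ → A} (hp : Antitone p) (hq : Antitone q)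
    (hp0 : IsGLB (range p) 0) (hq0 : IsGLB (range q) 0) :
    IsGLB (range fun m => p m + q m) 0 := by
  refine ⟨?_, fun b hb => ?_⟩
  · rintro _ ⟨m, rfl⟩
    exact add_nonneg (hp0.1 ⟨m, rfl⟩) (hq0.1 ⟨m, rfl⟩)
  · refine hp0.2 ?_
    rintro _ ⟨m, rfl⟩
    rw [← sub_nonpos]
    refine hq0.2 ?_
    rintro _ ⟨k, rfl⟩
    rw [sub_le_iff_le_add']
    exact (hb ⟨max m k, rfl⟩).trans
      (add_le_add (hp (le_max_left m k)) (hq (le_max_right m k)))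

/-- The Weierstrass test. -/
theorem convergesUniformlyInOrder_of_modulus_le {a : ℕ → Cplx A} {c : Cplx A}
    {D : Set (Cplx A)} {t : ℕ → A} (ht : ∀ n, ∀ z ∈ D, (a n * (z - c) ^ n).modulus ≤ t n)
    (hbdd : BddAbove (range fun m => ∑ n ∈ Finset.range (m + 1), t n)) :
    ConvergesUniformlyInOrder a c D := by
  rcases D.eq_empty_or_nonempty with rfl | ⟨z₀, hz₀⟩
  · exact ⟨0, 0, antitone_const, by simp, by simp⟩
  have ht0 : ∀ n, 0 ≤ t n := fun n => (modulus_nonneg _).trans (ht n z₀ hz₀)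
  set s : ℕ → A := fun m => ∑ n ∈ Finset.range (m + 1), t n with hs_def
  have hs : Monotone s := monotone_nat_of_le_succ fun m => by
    simp only [hs_def, Finset.sum_range_succ _ (m + 1)]
    exact le_add_of_nonneg_right (ht0 _)
  have hlub : IsLUB (range s) (sSup (range s)) := isLUB_csSup (range_nonempty _) hbdd
  set T := sSup (range s)
  set p : ℕ → A := fun m => T - s m with hp_def
  have hp : Antitone p := fun m k h => sub_le_sub_left (hs h) T
  have hp0 : IsGLB (range p) 0 := by
    refine ⟨?_, fun b hb => ?_⟩
    · rintro _ ⟨m, rfl⟩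
      exact sub_nonneg.2 (hlub.1 ⟨m, rfl⟩)
    · have : T ≤ T - b := hlub.2 (by
        rintro _ ⟨m, rfl⟩
        exact le_sub_comm.1 (hb ⟨m, rfl⟩))
      simpa using this
  have hp_nonneg : ∀ m, 0 ≤ p m := fun m => hp0.1 ⟨m, rfl⟩
  -- The limit of a real Cauchy sequence, as a supremum of lower bounds: each `x i - p i` lies below
  -- each `x j + p j`.
  have hreal : ∀ x : ℕ → A, (∀ m k, m ≤ k → |x m - x k| ≤ s k - s m) →
      ∀ m, |x m - ⨆ k, (x k - p k)| ≤ p m := by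
    intro x hx m
    have hup : ∀ i j, x i - p i ≤ x j + p j := by
      intro i j
      rw [sub_le_iff_le_add, ← sub_le_iff_le_add', ← sub_sub, sub_le_iff_le_add,
        add_comm]
      rcases le_total i j with h | h
      · have h1 := (le_abs_self _).trans (hx i j h)
        have h2 : s j - s i ≤ p i + p j := by
          have : p i + p j = (s j - s i) + (p j + p j) := by simp only [hp_def]; abel
          rw [this]
          exact le_add_of_nonneg_right (add_nonneg (hp_nonneg j) (hp_nonneg j))
        have h3 := h1.trans h2
        rw [sub_le_iff_le_add] at h3 ⊢
        refine h3.trans (le_of_eq (by abel))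
      · have h1 := (neg_le_abs _).trans (hx j i h)
        have h2 : s i - s j ≤ p i + p j := by
          have : p i + p j = (s i - s j) + (p i + p i) := by simp only [hp_def]; abel
          rw [this]
          exact le_add_of_nonneg_right (add_nonneg (hp_nonneg i) (hp_nonneg i))
        have h3 := h1.trans h2
        rw [neg_sub, sub_le_iff_le_add] at h3
        rw [sub_le_iff_le_add]
        refine h3.trans (le_of_eq (by abel))
    have hl : IsLUB (range fun k => x k - p k) (⨆ k, (x k - p k)) :=
      isLUB_csSup (range_nonempty _) ⟨x m + p m, by rintro _ ⟨k, rfl⟩; exact hup k m⟩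
    refine abs_le'.2 ⟨?_, ?_⟩
    · exact sub_le_comm.1 (hl.1 ⟨m, rfl⟩)
    · rw [neg_sub, sub_le_iff_le_add']
      exact hl.2 (by rintro _ ⟨k, rfl⟩; exact hup k m)
  set σ : ℕ → Cplx A → Cplx A := fun m z => ∑ n ∈ Finset.range (m + 1), a n * (z - c) ^ n
    with hσ_def
  have hσ : ∀ z ∈ D, ∀ m k, m ≤ k → (σ m z - σ k z).modulus ≤ s k - s m := by
    intro z hz m k h
    induction k, h using Nat.le_induction with
    | base => simp
    | succ k hk ih =>
      have h1 : σ m z - σ (k + 1) z = (σ m z - σ k z) + -(a (k + 1) * (z - c) ^ (k + 1)) := by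
        simp only [hσ_def, Finset.sum_range_succ _ (k + 1)]
        abel
      have h2 : s (k + 1) - s m = (s k - s m) + t (k + 1) := by
        simp only [hs_def, Finset.sum_range_succ _ (k + 1)]
        abel
      rw [h1, h2]
      exact (modulus_add_le _ _).trans
        (add_le_add ih ((modulus_neg_le _).trans (ht _ z hz)))
  refine ⟨fun z => ⟨⨆ k, ((σ k z).re - p k), ⨆ k, ((σ k z).im - p k)⟩, p, hp, hp0,
    fun m z hz => ?_⟩
  change (σ m z - _).modulus ≤ p m
  -- Real and imaginary parts together give only the error `p + p`. Passing through the partial sum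
  -- of index `max m k` reduces the error to `p m + p k`, and the infimum over `k` leaves `p m`.
  rw [← sub_nonpos]
  refine hp0.2 ?_
  rintro _ ⟨k, rfl⟩
  set w : Cplx A := ⟨⨆ k, ((σ k z).re - p k), ⨆ k, ((σ k z).im - p k)⟩
  have hk : ∀ k, (σ k z - w).modulus ≤ p k + p k := fun k =>
    (modulus_le_abs_add_abs _).trans (add_le_add
      (hreal (fun m => (σ m z).re)
        (fun i j h => (abs_re_le_modulus (σ i z - σ j z)).trans (hσ z hz i j h)) k)
      (hreal (fun m => (σ m z).im)
        (fun i j h => (abs_im_le_modulus (σ i z - σ j z)).trans (hσ z hz i j h)) k))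
  have h1 : (σ m z - w).modulus ≤ (p m - p (max m k)) + (p (max m k) + p (max m k)) := by
    have h2 : σ m z - w = (σ m z - σ (max m k) z) + (σ (max m k) z - w) := by abel
    rw [h2]
    refine (modulus_add_le _ _).trans (add_le_add ?_ (hk _))
    refine (hσ z hz _ _ (le_max_left m k)).trans (le_of_eq ?_)
    simp only [hp_def]
    abel
  rw [sub_le_iff_le_add']
  refine h1.trans ?_
  calc _ = p m + p (max m k) := by abel
    _ ≤ p m + p k := add_le_add le_rfl (hp (le_max_right m k))

end Series
end Modulus

/-! ### Radii of uniform convergence and the root test -/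

section RadiiSet

attribute [local instance] isOrderedRing_of_isFAlgebra isOrderedModule_real

variable {A : Type*} [Ring A] [ConditionallyCompleteLattice A] [IsOrderedAddMonoid A]
  [Algebra ℝ A] [PosSMulMono ℝ A]

open Cplx

theorem sum_mul_zero_pow {R : Type*} [Ring R] (a : ℕ → R) (m : ℕ) :
    ∑ n ∈ Finset.range (m + 1), a n * 0 ^ n = a 0 := by
  rw [Finset.sum_range_succ']
  simp

theorem zero_mem_radiiSet (a : ℕ → Cplx A) (c : Cplx A) : 0 ∈ radiiSet a c := by
  refine ⟨le_rfl, fun _ => a 0, 0, antitone_const, by simp, fun m z hz => ?_⟩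
  rw [eq_zero_of_modulus_nonpos hz, sum_mul_zero_pow, sub_self, modulus_zero]
  exact le_rfl

omit [IsOrderedAddMonoid A] [PosSMulMono ℝ A] in
theorem mem_radiiSet_of_le {a : ℕ → Cplx A} {c : Cplx A} {r s : A} (hr : r ∈ radiiSet a c)
    (hs : 0 ≤ s) (hsr : s ≤ r) : s ∈ radiiSet a c := by
  obtain ⟨_, S, p, hp, hp0, h⟩ := hr
  exact ⟨hs, S, p, hp, hp0, fun m z hz => h m z (le_trans hz hsr)⟩

variable [IsFAlgebra A]

/-- The ball of radius `r ⊔ s` splits along a component `e` with `e * s ≤ e * r` and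
`(1 - e) * r ≤ (1 - e) * s` into pieces in the balls of radii `r` and `s`. -/
theorem sup_mem_radiiSet {a : ℕ → Cplx A} {c : Cplx A} {r s : A} (hr : r ∈ radiiSet a c)
    (hs : s ∈ radiiSet a c) : r ⊔ s ∈ radiiSet a c := by
  obtain ⟨hr0, S, p, hp, hp0, hS⟩ := hr
  obtain ⟨hs0, S', q, hq, hq0, hS'⟩ := hs
  obtain ⟨e, he, h1, h2⟩ := exists_isComponent_compare r s
  have hsup := he.mul_sup_add_compl_mul h2 h1
  have her : e * (r ⊔ s) ≤ r := by
    rw [hsup, mul_add, ← mul_assoc, ← mul_assoc, he.mul_self, he.mul_compl, zero_mul, add_zero]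
    exact he.mul_le hr0
  have hes : (1 - e) * (r ⊔ s) ≤ s := by
    rw [hsup, mul_add, ← mul_assoc, ← mul_assoc, he.compl.mul_self, ← he.comm, he.mul_compl,
      zero_mul, zero_add]
    exact he.compl.mul_le hs0
  refine ⟨hr0.trans le_sup_left,
    fun z => S (c + ofReal e * (z - c)) + S' (c + (1 - ofReal e) * (z - c)) - a 0,
    fun m => p m + q m, hp.add hq, isGLB_add_of_antitone hp hq hp0 hq0, fun m z hz => ?_⟩
  set w := z - c with hw
  set E := ofReal e with hE
  have hwr : (E * w).modulus ≤ r := (modulus_ofReal_mul_le he w).trans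
    ((mul_le_mul_of_nonneg_left hz he.nonneg).trans her)
  have hws : ((1 - E) * w).modulus ≤ s := by
    rw [hE, ← ofReal_one_sub]
    exact (modulus_ofReal_mul_le he.compl w).trans
      ((mul_le_mul_of_nonneg_left hz he.compl.nonneg).trans hes)
  have hb := hS m (c + E * w) (by simpa [orderBall] using hwr)
  have hb' := hS' m (c + (1 - E) * w) (by simpa [orderBall] using hws)
  rw [add_sub_cancel_left] at hb hb'
  -- The term `0 ^ n` matters only for `n = 0`, where both pieces contribute `1`; in the sums it
  -- becomes `a 0`.
  have hpow : ∀ n, w ^ n = (E * w) ^ n + ((1 - E) * w) ^ n - 0 ^ n := by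
    intro n
    have k1 := mix_pow (ofReal_mul_self he) (ofReal_comm he) w 0 n
    have k2 := mix_pow (ofReal_mul_self he) (ofReal_comm he) 0 w n
    rw [mul_zero, add_zero] at k1
    rw [mul_zero, zero_add] at k2
    rw [hE, k1, k2]
    noncomm_ring
  have hsum : ∑ n ∈ Finset.range (m + 1), a n * w ^ n =
      ∑ n ∈ Finset.range (m + 1), a n * (E * w) ^ n +
        ∑ n ∈ Finset.range (m + 1), a n * ((1 - E) * w) ^ n - a 0 := by
    conv_rhs => rw [← sum_mul_zero_pow a m]
    rw [← Finset.sum_add_distrib, ← Finset.sum_sub_distrib]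
    refine Finset.sum_congr rfl fun n _ => ?_
    rw [hpow, mul_sub, mul_add]
  have hsplit : ∑ n ∈ Finset.range (m + 1), a n * w ^ n -
      (S (c + E * w) + S' (c + (1 - E) * w) - a 0) =
      (∑ n ∈ Finset.range (m + 1), a n * (E * w) ^ n - S (c + E * w)) +
        (∑ n ∈ Finset.range (m + 1), a n * ((1 - E) * w) ^ n - S' (c + (1 - E) * w)) := by
    rw [hsum]
    abel
  rw [hsplit]
  exact (modulus_add_le _ _).trans (add_le_add hb hb')

theorem isSolidSublatticeOfCone_radiiSet (a : ℕ → Cplx A) (c : Cplx A) :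
    IsSolidSublatticeOfCone (radiiSet a c) where
  nonneg _ hr := hr.1
  nonempty := ⟨0, zero_mem_radiiSet a c⟩
  solid _ hr _ hs hsr := mem_radiiSet_of_le hr hs hsr
  sup_mem _ hr _ hs := sup_mem_radiiSet hr hs
  inf_mem _ hr _ hs := mem_radiiSet_of_le hr (le_inf hr.1 hs.1) inf_le_left

variable [IsArchimedeanLattice A]

theorem rootSeq_spec (a : ℕ → Cplx A) (k : ℕ) :
    0 ≤ rootSeq a k ∧ rootSeq a k ^ (k + 1) = (a (k + 1)).modulus :=
  nthRoot_spec (modulus_nonneg _) k.succ_ne_zero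

variable [IsUniversallyComplete A]

/-- A form of the root test: if `v` decreases to an element that is disjoint to `r` and
`|a_{n+1}| ≤ v_n^{n+1}`, then `r` is a radius of uniform order convergence. -/
theorem mem_radiiSet_of_modulus_le_pow {a : ℕ → Cplx A} {c : Cplx A} {v : ℕ → A} {L r : A}
    (hv : Antitone v) (hvL : IsGLB (range v) L) (hL : 0 ≤ L) (hr : 0 ≤ r) (hLr : L * r = 0)
    (hav : ∀ k, (a (k + 1)).modulus ≤ v k ^ (k + 1)) : r ∈ radiiSet a c := by
  have hv0 : ∀ n, 0 ≤ v n := fun n => hL.trans (hvL.1 ⟨n, rfl⟩)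
  -- The `8` is `2 * 4`: off `e N` the later factors satisfy `v k * r ≤ 1/8`, which beats the `4 ^
  -- n` from `modulus_mul_pow_le` and leaves `2⁻¹ ^ n`.
  set e : ℕ → A := fun n => supportComponent ((8 : ℝ) • (v n * r) - 1)
  have he : ∀ n, IsComponent (e n) := fun n => isComponent_supportComponent _
  have he_anti : Antitone e := fun m n h => supportComponent_mono
    (sub_le_sub_right (smul_le_smul_of_nonneg_left
      (mul_le_mul_of_nonneg_right (hv h) hr) (by norm_num)) _)
  have he_le : ∀ n, e n ≤ (8 : ℝ) • (v n * r) := by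
    intro n
    have h1 := supportComponent_mul_nonneg ((8 : ℝ) • (v n * r) - 1)
    rw [mul_sub, mul_one, sub_nonneg] at h1
    exact h1.trans ((he n).mul_le (smul_nonneg (by norm_num) (mul_nonneg (hv0 n) hr)))
  have he0 : IsGLB (range e) 0 := by
    refine ⟨by rintro _ ⟨n, rfl⟩; exact (he n).nonneg, fun b hb => ?_⟩
    have h1 : b ≤ ((8 : ℝ) • (1 : A)) * L * r := by
      refine le_mul_mul_of_isGLB hvL (smul_nonneg (by norm_num) zero_le_one) hr ?_
      rintro _ ⟨n, rfl⟩
      rw [smul_one_mul, smul_mul_assoc]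
      exact (hb ⟨n, rfl⟩).trans (he_le n)
    rwa [mul_assoc, hLr, mul_zero] at h1
  have hcompl : ∀ N k, N ≤ k → (1 - e N) * (v k * r) ≤ (8 : ℝ)⁻¹ • (1 - e N) := by
    intro N k h
    have h1 := compl_supportComponent_mul_nonpos ((8 : ℝ) • (v N * r) - 1)
    rw [mul_sub, mul_one, sub_nonpos, mul_smul_comm] at h1
    have h2 := smul_le_smul_of_nonneg_left h1 (show (0 : ℝ) ≤ 8⁻¹ by norm_num)
    rw [smul_smul, inv_mul_cancel₀ (by norm_num), one_smul] at h2
    exact (mul_le_mul_of_nonneg_left (mul_le_mul_of_nonneg_right (hv h) hr)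
      (he N).compl.nonneg).trans h2
  have hpow : ∀ N k, N ≤ k → ∀ j : ℕ,
      (1 - e N) * (v k ^ j * r ^ j) ≤ ((8 : ℝ)⁻¹ ^ j) • (1 - e N) := by
    intro N k h j
    induction j with
    | zero => simp
    | succ j ih =>
      have hg := (he N).compl
      have hvj := pow_nonneg (hv0 k) j
      have hrj := pow_nonneg hr j
      calc (1 - e N) * (v k ^ (j + 1) * r ^ (j + 1))
          = v k ^ j * ((1 - e N) * (v k * r)) * r ^ j := by
            rw [pow_succ, pow_succ' r, hg.comm (v k * r)]
            simp only [← mul_assoc]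
            rw [mul_assoc _ (1 - e N), hg.comm (r ^ j), hg.comm]
            simp only [mul_assoc, hg.comm]
        _ ≤ v k ^ j * ((8 : ℝ)⁻¹ • (1 - e N)) * r ^ j := by
            have := hcompl N k h
            gcongr
        _ = (8 : ℝ)⁻¹ • ((1 - e N) * (v k ^ j * r ^ j)) := by
            rw [mul_smul_comm, smul_mul_assoc, ← hg.comm, mul_assoc]
        _ ≤ (8 : ℝ)⁻¹ • (((8 : ℝ)⁻¹ ^ j) • (1 - e N)) :=
            smul_le_smul_of_nonneg_left ih (by norm_num)
        _ = _ := by rw [smul_smul, pow_succ']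
  set t : ℕ → A := fun n => ((4 : ℝ) ^ n) • ((a n).modulus * r ^ n) with ht_def
  have ht0 : ∀ n, 0 ≤ t n := fun n =>
    smul_nonneg (by positivity) (mul_nonneg (modulus_nonneg _) (pow_nonneg hr n))
  have ht : ∀ N k, N ≤ k → (1 - e N) * t (k + 1) ≤ ((2 : ℝ)⁻¹ ^ (k + 1)) • (1 : A) := by
    intro N k h
    have hg := (he N).compl.nonneg
    calc (1 - e N) * t (k + 1)
        ≤ (1 - e N) * (((4 : ℝ) ^ (k + 1)) • (v k ^ (k + 1) * r ^ (k + 1))) := by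
          refine mul_le_mul_of_nonneg_left (smul_le_smul_of_nonneg_left ?_ (by positivity)) hg
          exact mul_le_mul_of_nonneg_right (hav k) (pow_nonneg hr _)
      _ ≤ ((4 : ℝ) ^ (k + 1)) • (((8 : ℝ)⁻¹ ^ (k + 1)) • (1 - e N)) := by
          rw [mul_smul_comm]
          exact smul_le_smul_of_nonneg_left (hpow N k h _) (by positivity)
      _ = ((2 : ℝ)⁻¹ ^ (k + 1)) • (1 - e N) := by
          rw [smul_smul, ← mul_pow]
          norm_num
      _ ≤ _ := smul_le_smul_of_nonneg_left (he N).compl.le_one (by positivity)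
  refine ⟨hr, convergesUniformlyInOrder_of_modulus_le (t := t)
    (fun n z hz => modulus_mul_pow_le _ _ hz n) ?_⟩
  set s : ℕ → A := fun m => ∑ n ∈ Finset.range (m + 1), t n with hs_def
  have hs_succ : ∀ m, s (m + 1) = s m + t (m + 1) := fun m => Finset.sum_range_succ _ _
  have hs0 : ∀ m, 0 ≤ s m := fun m => Finset.sum_nonneg fun n _ => ht0 n
  have hs : Monotone s := monotone_nat_of_le_succ fun m => by
    rw [hs_succ]
    exact le_add_of_nonneg_right (ht0 _)
  have h2one : (0 : A) ≤ (2 : ℝ) • 1 := smul_nonneg (by norm_num) zero_le_one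
  refine bddAbove_range_of_forall_compl (c := fun N => s N + (2 : ℝ) • 1) he he_anti he0
    (fun N => add_nonneg (hs0 N) h2one) fun N m => ?_
  have hg := (he N).compl
  have hsmall : ∀ m ≤ N, ∀ x : ℝ, 0 ≤ x → (1 - e N) * s m ≤ s N + x • 1 := fun m hm x hx =>
    ((hg.mul_le (hs0 m)).trans (hs hm)).trans
      (le_add_of_nonneg_right (smul_nonneg hx zero_le_one))
  have hhalf : ∀ m : ℕ, (2 : ℝ)⁻¹ ^ m ≤ 1 := fun m => pow_le_one₀ (by norm_num) (by norm_num)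
  -- The bound `2 - 2⁻¹ ^ m`, rather than `2`, leaves room for the next term `2⁻¹ ^ (m + 1)`. Up to
  -- index `N`, monotonicity of `s` suffices.
  have key : (1 - e N) * s m ≤ s N + (2 - (2 : ℝ)⁻¹ ^ m) • 1 := by
    induction m with
    | zero => exact hsmall 0 (Nat.zero_le N) _ (by norm_num)
    | succ m ih =>
      rcases lt_or_ge m N with h | h
      · exact hsmall (m + 1) h _ (by linarith [hhalf (m + 1)])
      · rw [hs_succ, mul_add]
        refine (add_le_add ih (ht N m h)).trans (le_of_eq ?_)
        rw [add_assoc, ← add_smul]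
        congr 2
        ring
  refine key.trans (add_le_add le_rfl (smul_le_smul_of_nonneg_right ?_ zero_le_one))
  have : (0 : ℝ) ≤ (2 : ℝ)⁻¹ ^ m := by positivity
  linarith

theorem mem_radiiSet_of_inf_orderLimsup_eq_zero {a : ℕ → Cplx A} {c : Cplx A} {r : A}
    (hr : 0 ≤ r) (ha : IsOrderBounded (range (rootSeq a)))
    (h : ofReal r ∈ disjointComplement
      (bandGenerated (ofReal (orderLimsup (rootSeq a))) : Set (Cplx A))) :
    r ∈ radiiSet a c := by
  set b := rootSeq a with hb_def
  have hb0 : ∀ k, 0 ≤ b k := fun k => (rootSeq_spec a k).1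
  obtain ⟨l, u, hlu⟩ := ha
  have hbu : ∀ k, b k ≤ u := fun k => (hlu ⟨k, rfl⟩).2
  set v : ℕ → A := fun n => ⨆ m : Ici n, b m with hv_def
  have hv : ∀ n, IsLUB (range fun m : Ici n => b m) (v n) := fun n =>
    have : Nonempty (Ici n) := ⟨⟨n, self_mem_Ici⟩⟩
    isLUB_csSup (range_nonempty _) ⟨u, by rintro _ ⟨m, rfl⟩; exact hbu m⟩
  have hbv : ∀ n, b n ≤ v n := fun n => (hv n).1 ⟨⟨n, self_mem_Ici⟩, rfl⟩
  have hv_anti : Antitone v := fun m n hmn => (hv n).2 (by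
    rintro _ ⟨k, rfl⟩
    exact (hv m).1 ⟨⟨k, hmn.trans k.2⟩, rfl⟩)
  have hvL : IsGLB (range v) (orderLimsup b) := isGLB_csInf (range_nonempty _)
    ⟨0, by rintro _ ⟨n, rfl⟩; exact (hb0 n).trans (hbv n)⟩
  have hL : 0 ≤ orderLimsup b := hvL.2 (by
    rintro _ ⟨n, rfl⟩
    exact (hb0 n).trans (hbv n))
  have hmem : ofReal (orderLimsup b) ∈ bandGenerated (ofReal (orderLimsup b)) := by
    rw [bandGenerated, Submodule.mem_sInf]
    exact fun B hB => hB.2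
  -- Of the whole band only its generator is needed.
  have hdisj : orderLimsup b ⊓ r = 0 := by
    refine le_antisymm ?_ (le_inf hL hr)
    rw [← h _ hmem, inf_comm]
    exact inf_le_inf ((le_abs_self r).trans (abs_re_le_modulus (ofReal r)))
      ((le_abs_self _).trans (abs_re_le_modulus (ofReal (orderLimsup b))))
  refine mem_radiiSet_of_modulus_le_pow hv_anti hvL hL hr
    (mul_eq_zero_of_inf_eq_zero hdisj) fun k => ?_
  rw [← (rootSeq_spec a k).2]
  exact pow_le_pow_left₀ (hb0 k) (hbv k) _

end RadiiSet
end CVL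

theorem proposition3p9 {A : Type*} [Ring A] [ConditionallyCompleteLattice A]
    [IsOrderedAddMonoid A] [Algebra ℝ A] [PosSMulMono ℝ A]
    [CVL.IsArchimedeanLattice A] [CVL.IsUniversallyComplete A] [CVL.IsFAlgebra A]
    (a : ℕ → CVL.Cplx A) (c : CVL.Cplx A) :
    CVL.IsSolidSublatticeOfCone (CVL.radiiSet a c) ∧
    (CVL.IsOrderBounded (Set.range (CVL.rootSeq a)) →
      ∀ r : A, 0 ≤ r →
        CVL.Cplx.ofReal r ∈ CVL.disjointComplement
          (CVL.bandGenerated (CVL.Cplx.ofReal (CVL.orderLimsup (CVL.rootSeq a))) :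
            Set (CVL.Cplx A)) →
        r ∈ CVL.radiiSet a c) :=
  ⟨CVL.isSolidSublatticeOfCone_radiiSet a c,
    fun ha _ hr h => CVL.mem_radiiSet_of_inf_orderLimsup_eq_zero hr ha h⟩
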